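/- Let $\mathbb K\in\{\mathbb R,\mathbb C\}$, let $X$ be a Banach space over $\mathbb K$, and let $X'$ be its topological dual with the dual norm. All operators are bounded and linear, and "weakly" always refers to the weak topology $\sigma(E,E')$ of the Banach space $E$ in question (so to $\sigma(X',X'')$ on $X'$). A norm bounded set $A\subseteq X$ is a *Dunford--Pettis (DP) set* if $\lim_{n\to\infty}\sup_{x\in A}|f_n(x)|=0$ for every weakly null sequence $(f_n)$ in $X'$. A norm bounded set $A\subseteq X'$ is an *L-Dunford--Pettis set* if $\lim_{n\to\infty}\sup_{f\in A}|f(x_n)|=0$ for every weakly null sequence $(x_n)$ in $X$ such that $\{x_n : n\in\mathbb N\}$ is a DP set. An operator $T\colon X\to Y$ into a Banach space $Y$ is *Dunford--Pettis completely continuous (DPcc)* if $\|Tx_n\|\to 0$ for every weakly null sequence $(x_n)$ in $X$ such that $\{x_n : n\in\mathbb N\}$ is a DP set; it is *weakly compact* if it maps the closed unit ball of $X$ onto a relatively weakly compact subset of $Y$. The space $X$ has the *L-Dunford--Pettis property* if every L-Dunford--Pettis set in $X'$ is relatively weakly compact. Then the following are equivalent: 1. $X$ has the L-Dunford--Pettis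 property; 2. for every Banach space $Y$ over $\mathbb K$, every DPcc operator from $X$ into $Y$ is weakly compact; 3. every DPcc operator from $X$ into $\ell^\infty$ is weakly compact, where $\ell^\infty$ is the Banach space of all bounded $\mathbb K$-valued sequences with the supremum norm. -/

import Mathlib

open Filter Topology Set
open scoped ENNReal
universe u v

section LDP

variable (𝕜 : Type) [RCLike 𝕜]

/-- A sequence is weakly null if it converges to `0` in the weak topology `σ(E, E')`. -/
def WeaklyNull {E : Type*} [NormedAddCommGroup E] [NormedSpace 𝕜 E] (x : ℕ → E) : Prop :=
  Tendsto (fun n => toWeakSpace 𝕜 E (x n)) atTop (𝓝 0)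

/-- A subset is relatively weakly compact if its closure in the weak topology `σ(E, E')` is
compact in that topology. -/
def RelativelyWeaklyCompact {E : Type*} [NormedAddCommGroup E] [NormedSpace 𝕜 E]
    (A : Set E) : Prop :=
  IsCompact (closure (toWeakSpace 𝕜 E '' A))

/-- A norm bounded set `A ⊆ X` is a Dunford-Pettis set if every weakly null sequence of the
(normed) dual `X'` converges to zero uniformly on `A`. -/
def IsDPSet {X : Type*} [NormedAddCommGroup X] [NormedSpace 𝕜 X] (A : Set X) : Prop :=
  Bornology.IsBounded A ∧
    ∀ f : ℕ → StrongDual 𝕜 X, WeaklyNull 𝕜 f →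
      TendstoUniformlyOn (fun n x => f n x) (fun _ => (0 : 𝕜)) atTop A

/-- A norm bounded set `A ⊆ X'` is an L-Dunford-Pettis set if every weakly null sequence of `X`
whose range is a Dunford-Pettis set converges to zero uniformly on `A`. -/
def IsLDPSet {X : Type*} [NormedAddCommGroup X] [NormedSpace 𝕜 X]
    (A : Set (StrongDual 𝕜 X)) : Prop :=
  Bornology.IsBounded A ∧
    ∀ x : ℕ → X, WeaklyNull 𝕜 x → IsDPSet 𝕜 (range x) →
      TendstoUniformlyOn (fun n (f : StrongDual 𝕜 X) => f (x n)) (fun _ => (0 : 𝕜)) atTop A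

/-- The L-Dunford-Pettis property: every L-Dunford-Pettis subset of `X'` is relatively weakly
compact, for the weak topology `σ(X', X'')`. -/
def HasLDPProperty (X : Type*) [NormedAddCommGroup X] [NormedSpace 𝕜 X] : Prop :=
  ∀ A : Set (StrongDual 𝕜 X), IsLDPSet 𝕜 A → RelativelyWeaklyCompact 𝕜 A

variable {𝕜}

/-- Dunford-Pettis completely continuous operators: weakly null sequences whose range is a
Dunford-Pettis set are mapped to norm null sequences. -/
def IsDPcc {X Y : Type*} [NormedAddCommGroup X] [NormedSpace 𝕜 X]
    [NormedAddCommGroup Y] [NormedSpace 𝕜 Y] (T : X →L[𝕜] Y) : Prop :=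
  ∀ x : ℕ → X, WeaklyNull 𝕜 x → IsDPSet 𝕜 (range x) →
    Tendsto (fun n => T (x n)) atTop (𝓝 0)

/-- Weakly compact operators: the image of the closed unit ball is relatively weakly compact. -/
def IsWeaklyCompactOperator {X Y : Type*} [NormedAddCommGroup X] [NormedSpace 𝕜 X]
    [NormedAddCommGroup Y] [NormedSpace 𝕜 Y] (T : X →L[𝕜] Y) : Prop :=
  RelativelyWeaklyCompact 𝕜 (T '' Metric.closedBall (0 : X) 1)

end LDP

/-! ### Weak and weak-star topologies; from the adjoint back to the operator. -/

section WeakTopology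

set_option maxSynthPendingDepth 3

variable {𝕜 : Type*} [RCLike 𝕜]

/-! Since `‖T x‖` is the supremum of `‖g (T x)‖` over the dual unit ball, a DPcc operator has an
adjoint sending that ball to an L-Dunford-Pettis set. Under the L-Dunford-Pettis property the
adjoint is then weakly compact, hence so is `T` (one half of Gantmacher's theorem). Conversely, a
sequence `f n` in an L-Dunford-Pettis set gives the DPcc operator `x ↦ (f n x)` into `ℓ^∞`. If it is
weakly compact, so is its adjoint (the other half), which sends the coordinate functionals to the `f
n`. Thus countable subsets are relatively weakly compact, and an Eberlein-type closing-off argument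
extends this to the whole set. -/

theorem WeakSpace.continuous_eval {E : Type*} [NormedAddCommGroup E] [NormedSpace 𝕜 E]
    (f : StrongDual 𝕜 E) :
    Continuous fun x : WeakSpace 𝕜 E => f ((toWeakSpace 𝕜 E).symm x) :=
  WeakBilin.eval_continuous (topDualPairing 𝕜 E).flip f

theorem WeakSpace.continuous_of_continuous_eval {α E : Type*} [TopologicalSpace α]
    [NormedAddCommGroup E] [NormedSpace 𝕜 E] {g : α → WeakSpace 𝕜 E}
    (h : ∀ f : StrongDual 𝕜 E, Continuous fun a => f ((toWeakSpace 𝕜 E).symm (g a))) :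
    Continuous g :=
  WeakBilin.continuous_of_continuous_eval (topDualPairing 𝕜 E).flip h

/-- A map into a compact set is continuous as soon as its composition with some continuous
injection into a Hausdorff space is. -/
theorem IsCompact.continuousOn_of_comp {α β γ : Type*} [TopologicalSpace α] [TopologicalSpace β]
    [TopologicalSpace γ] [T2Space γ] {K : Set β} (hK : IsCompact K) {j : β → γ}
    (hj : Continuous j) (hinj : Function.Injective j) {B : Set α} {s : α → β}
    (hs : MapsTo s B K) (hc : ContinuousOn (fun a => j (s a)) B) : ContinuousOn s B := by
  have : CompactSpace K := isCompact_iff_compactSpace.mp hK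
  have he : IsEmbedding (fun k : K => j k) :=
    ((hj.comp continuous_subtype_val).isClosedEmbedding
      (hinj.comp Subtype.val_injective)).isEmbedding
  have h1 : Continuous (fun a : B => (⟨s a, hs a.2⟩ : K)) := by
    rw [he.continuous_iff]
    exact continuousOn_iff_continuous_domRestrict.mp hc
  exact continuousOn_iff_continuous_domRestrict.mpr (continuous_subtype_val.comp h1)

/-- A functional on the dual of a Banach space whose restriction to the unit ball is weak-star
continuous at the origin is the evaluation at some point. -/
theorem exists_eval_eq_of_continuousWithinAt {Y : Type*} [NormedAddCommGroup Y] [NormedSpace 𝕜 Y]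
    [CompleteSpace Y] (φ : StrongDual 𝕜 (StrongDual 𝕜 Y))
    (hφ : ContinuousWithinAt (fun g : WeakDual 𝕜 Y => φ (WeakDual.toStrongDual g))
      (WeakDual.toStrongDual ⁻¹' Metric.closedBall 0 1) 0) :
    ∃ y : Y, NormedSpace.inclusionInDoubleDual 𝕜 Y y = φ := by
  have hemb := (NormedSpace.inclusionInDoubleDualLi (E := Y) 𝕜).isometry.isUniformInducing
  have hcl : IsClosed (range (NormedSpace.inclusionInDoubleDual 𝕜 Y)) := hemb.isComplete_range.isClosed
  change φ ∈ range (NormedSpace.inclusionInDoubleDual 𝕜 Y)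
  rw [← hcl.closure_eq, Metric.mem_closure_iff]
  intro ε hε
  have hev : ∀ᶠ g in 𝓝[WeakDual.toStrongDual ⁻¹' Metric.closedBall 0 1] (0 : WeakDual 𝕜 Y),
      ‖φ (WeakDual.toStrongDual g)‖ < ε / 2 := by
    have h1 := hφ.norm
    rw [ContinuousWithinAt] at h1
    refine h1.eventually_lt_const ?_
    simpa using by positivity
  rw [eventually_nhdsWithin_iff] at hev
  obtain ⟨⟨s, δ⟩, hδ, hs⟩ :=
    (WeakDual.withSeminorms (𝕜 := 𝕜) (E := Y)).hasBasis_zero_ball.eventually_iff.mp hev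
  simp only at hδ hs
  -- `p` lies in the basic neighbourhood given by `s` and `δ`, so `φ` is small on its unit ball.
  -- Subtracting a Hahn-Banach extension `ψ` of `φ` restricted to `p` leaves a functional vanishing
  -- on `p`, hence a combination of evaluations at points of `s`, within `ε` of `φ`.
  let p : Submodule 𝕜 (StrongDual 𝕜 Y) :=
    ⨅ y : s, LinearMap.ker (NormedSpace.inclusionInDoubleDual 𝕜 Y y : StrongDual 𝕜 Y →ₗ[𝕜] 𝕜)
  have hp : ∀ g : StrongDual 𝕜 Y, g ∈ p → ∀ y ∈ s, g y = 0 := by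
    intro g hg y hy
    have := (Submodule.mem_iInf _).mp hg ⟨y, hy⟩
    simpa using this
  have hball : ∀ g ∈ p, ‖g‖ ≤ 1 → ‖φ g‖ < ε / 2 := by
    intro g hg hg1
    refine hs (x := StrongDual.toWeakDual g) ?_ (by simpa using hg1)
    rw [Seminorm.mem_ball, sub_zero]
    refine Seminorm.finset_sup_apply_lt hδ fun y hy => ?_
    rw [WeakDual.seminormFamily_apply, StrongDual.toWeakDual_apply, hp g hg y hy, norm_zero]
    exact hδ
  obtain ⟨ψ, hψ, hψn⟩ := exists_extension_norm_eq p (φ.comp p.subtypeL)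
  have hle : ‖ψ‖ ≤ ε / 2 := by
    rw [hψn]
    refine le_of_forall_lt fun r hr => ?_
    obtain ⟨x, hx, hrx⟩ := ContinuousLinearMap.exists_lt_apply_of_lt_opNorm _ hr
    exact hrx.trans (hball x x.2 hx.le)
  have hmem : ((φ - ψ : StrongDual 𝕜 (StrongDual 𝕜 Y)) : StrongDual 𝕜 Y →ₗ[𝕜] 𝕜) ∈
      Submodule.span 𝕜 (range fun y : s =>
        (NormedSpace.inclusionInDoubleDual 𝕜 Y y : StrongDual 𝕜 Y →ₗ[𝕜] 𝕜)) := by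
    refine mem_span_of_iInf_ker_le_ker fun g hg => ?_
    have := hψ ⟨g, hg⟩
    simp only [ContinuousLinearMap.comp_apply, Submodule.subtypeL_apply] at this
    simp [this]
  obtain ⟨c, hc⟩ := (Submodule.mem_span_range_iff_exists_fun 𝕜).mp hmem
  refine ⟨_, ⟨∑ y : s, c y • (y : Y), rfl⟩, ?_⟩
  have heq : NormedSpace.inclusionInDoubleDual 𝕜 Y (∑ y : s, c y • (y : Y)) = φ - ψ := by
    ext g
    have := LinearMap.congr_fun hc g
    simp only [LinearMap.sum_apply, LinearMap.smul_apply] at this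
    simpa [map_sum] using this
  rw [heq, dist_eq_norm, sub_sub_cancel]
  linarith

/-- An operator into a Banach space is weakly compact if its adjoint is. -/
theorem isWeaklyCompactOperator_of_adjoint {𝕜 : Type} [RCLike 𝕜] {X Y : Type*}
    [NormedAddCommGroup X] [NormedSpace 𝕜 X] [NormedAddCommGroup Y] [NormedSpace 𝕜 Y]
    [CompleteSpace Y] (T : X →L[𝕜] Y)
    (h : RelativelyWeaklyCompact 𝕜
      ((fun g : StrongDual 𝕜 Y => g.comp T) '' Metric.closedBall 0 1)) :
    IsWeaklyCompactOperator T := by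
  -- On a weakly compact subset of the dual the weak and weak-star topologies agree, so weak-star
  -- continuity of the adjoint improves to weak continuity on the ball.
  have hcont : ContinuousOn
      (fun g : WeakDual 𝕜 Y => toWeakSpace 𝕜 (StrongDual 𝕜 X) ((WeakDual.toStrongDual g).comp T))
      (WeakDual.toStrongDual ⁻¹' Metric.closedBall 0 1) := by
    refine IsCompact.continuousOn_of_comp h
      (j := fun f => StrongDual.toWeakDual ((toWeakSpace 𝕜 (StrongDual 𝕜 X)).symm f)) ?_ ?_ ?_ ?_
    · exact WeakDual.continuous_of_continuous_eval fun x =>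
        WeakSpace.continuous_eval (NormedSpace.inclusionInDoubleDual 𝕜 X x)
    · exact StrongDual.toWeakDual.injective.comp (toWeakSpace 𝕜 (StrongDual 𝕜 X)).symm.injective
    · intro g hg
      exact subset_closure ⟨_, ⟨_, hg, rfl⟩, rfl⟩
    · exact (WeakDual.continuous_of_continuous_eval fun x =>
        WeakDual.eval_continuous (T x)).continuousOn
  let D : WeakDual 𝕜 (StrongDual 𝕜 X) → WeakDual 𝕜 (StrongDual 𝕜 Y) := fun φ =>
    StrongDual.toWeakDual ((WeakDual.toStrongDual φ).comp (ContinuousLinearMap.precomp 𝕜 T))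
  have hD : Continuous D := WeakDual.continuous_of_continuous_eval fun g =>
    WeakDual.eval_continuous (g.comp T)
  have hrange : ∀ φ, D φ ∈ range (NormedSpace.inclusionInDoubleDualWeak 𝕜 Y) := by
    intro φ
    obtain ⟨y, hy⟩ := exists_eval_eq_of_continuousWithinAt
      ((WeakDual.toStrongDual φ).comp (ContinuousLinearMap.precomp 𝕜 T))
      (((WeakSpace.continuous_eval (WeakDual.toStrongDual φ)).comp_continuousOn hcont) 0
        (by simp))
    exact ⟨toWeakSpace 𝕜 Y y, congrArg StrongDual.toWeakDual hy⟩
  refine NormedSpace.isCompact_closure_of_isBounded 𝕜 Y _ ?_ ?_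
  · rw [preimage_image_eq _ (toWeakSpace 𝕜 Y).injective]
    exact T.lipschitz.isBounded_image Metric.isBounded_closedBall
  -- By Banach-Alaoglu the second adjoint `D` maps the bidual ball onto a weak-star compact set; it
  -- contains the image of the ball of `X` and lies in `Y`.
  · refine (closure_minimal ?_ ((WeakDual.isCompact_closedBall (𝕜 := 𝕜)
      (0 : StrongDual 𝕜 (StrongDual 𝕜 X)) 1).image hD).isClosed).trans ?_
    · rintro _ ⟨_, ⟨_, ⟨x, hx, rfl⟩, rfl⟩, rfl⟩
      refine ⟨StrongDual.toWeakDual (NormedSpace.inclusionInDoubleDual 𝕜 X x), ?_, rfl⟩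
      rw [mem_closedBall_zero_iff] at hx
      simpa using (NormedSpace.double_dual_bound 𝕜 X x).trans hx
    · rintro _ ⟨φ, -, rfl⟩
      exact hrange φ

end WeakTopology

/-! ### Gantmacher's theorem: from the operator to its adjoint. -/

section Gantmacher

set_option maxSynthPendingDepth 3

variable {𝕜 : Type} [RCLike 𝕜] {X Y : Type*} [NormedAddCommGroup X] [NormedSpace 𝕜 X]
    [NormedAddCommGroup Y] [NormedSpace 𝕜 Y]

/-- The second adjoint of a weakly compact operator maps the unit ball of the bidual into
the codomain. -/
theorem IsWeaklyCompactOperator.exists_eval_eq_of_norm_le_one {T : X →L[𝕜] Y}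
    (hT : IsWeaklyCompactOperator T) (φ : StrongDual 𝕜 (StrongDual 𝕜 X)) (hφ : ‖φ‖ ≤ 1) :
    ∃ y : Y, ∀ g : StrongDual 𝕜 Y, φ (g.comp T) = g y := by
  let D : WeakDual 𝕜 (StrongDual 𝕜 Y) :=
    StrongDual.toWeakDual (φ.comp (ContinuousLinearMap.precomp 𝕜 T))
  let K : Set (WeakDual 𝕜 (StrongDual 𝕜 Y)) := NormedSpace.inclusionInDoubleDualWeak 𝕜 Y ''
    closure (toWeakSpace 𝕜 Y '' (T '' Metric.closedBall 0 1))
  have hK : IsCompact K := IsCompact.image hT (NormedSpace.inclusionInDoubleDualWeak 𝕜 Y).continuous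
  have hconv : Convex ℝ K := by
    rintro _ ⟨x, hx, rfl⟩ _ ⟨y, hy, rfl⟩ a b ha hb hab
    refine ⟨(a : 𝕜) • x + (b : 𝕜) • y, ?_, ?_⟩
    · refine map_mem_closure₂ (f := fun x y : WeakSpace 𝕜 Y => (a : 𝕜) • x + (b : 𝕜) • y)
        (by fun_prop) hx hy ?_
      rintro _ ⟨_, ⟨p, hp, rfl⟩, rfl⟩ _ ⟨_, ⟨q, hq, rfl⟩, rfl⟩
      refine ⟨T ((a : 𝕜) • p + (b : 𝕜) • q), ⟨_, ?_, rfl⟩, by simp⟩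
      rw [mem_closedBall_zero_iff] at hp hq ⊢
      calc ‖(a : 𝕜) • p + (b : 𝕜) • q‖ ≤ ‖(a : 𝕜) • p‖ + ‖(b : 𝕜) • q‖ := norm_add_le _ _
        _ = a * ‖p‖ + b * ‖q‖ := by
          rw [norm_smul, norm_smul, RCLike.norm_of_nonneg ha, RCLike.norm_of_nonneg hb]
        _ ≤ a * 1 + b * 1 := by gcongr
        _ = 1 := by linarith
    · rw [map_add, map_smul, map_smul, RCLike.real_smul_eq_coe_smul (K := 𝕜) a,
        RCLike.real_smul_eq_coe_smul (K := 𝕜) b]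
  suffices h : D ∈ K by
    obtain ⟨y, -, hy⟩ := h
    exact ⟨(toWeakSpace 𝕜 Y).symm y, fun g => (DFunLike.congr_fun hy g).symm⟩
  -- A functional `g` separating `D` from `K` would satisfy `‖g.comp T‖ ≤ r < re (φ (g.comp T))`,
  -- impossible for `‖φ‖ ≤ 1`.
  by_contra hDK
  have : LocallyConvexSpace ℝ (WeakDual 𝕜 (StrongDual 𝕜 Y)) :=
    inferInstanceAs (LocallyConvexSpace ℝ (WeakBilin (topDualPairing 𝕜 (StrongDual 𝕜 Y))))
  obtain ⟨l, r, hl, hr⟩ := RCLike.geometric_hahn_banach_closed_point (𝕜 := 𝕜) hconv hK.isClosed hDK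
  obtain ⟨g, rfl⟩ := LinearMap.dualEmbedding_surjective (topDualPairing 𝕜 (StrongDual 𝕜 Y)) l
  have hr' : r < RCLike.re (φ (g.comp T)) := hr
  have hl' : ∀ x : X, ‖x‖ ≤ 1 → RCLike.re (g (T x)) < r := fun x hx =>
    hl _ ⟨_, subset_closure ⟨_, ⟨x, by simpa using hx, rfl⟩, rfl⟩, rfl⟩
  have hn : ‖g.comp T‖ ≤ r := by
    refine le_of_forall_lt fun c hc => ?_
    obtain ⟨x, hx, hcx⟩ := ContinuousLinearMap.exists_lt_apply_of_lt_opNorm _ hc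
    refine hcx.trans ?_
    -- A unimodular factor turns the bound on real parts into a bound on norms.
    obtain ⟨a, ha, hax⟩ := RCLike.exists_norm_eq_mul_self ((g.comp T) x)
    have h1 := hl' (a • x) (by rw [norm_smul, ha, one_mul]; exact hx.le)
    rw [ContinuousLinearMap.comp_apply] at hax ⊢
    rwa [map_smul, map_smul, smul_eq_mul, ← hax, RCLike.ofReal_re] at h1
  have : RCLike.re (φ (g.comp T)) ≤ r := calc
    RCLike.re (φ (g.comp T)) ≤ ‖φ (g.comp T)‖ := RCLike.re_le_norm _
    _ ≤ ‖φ‖ * ‖g.comp T‖ := φ.le_opNorm _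
    _ ≤ ‖g.comp T‖ := mul_le_of_le_one_left (norm_nonneg _) hφ
    _ ≤ r := hn
  linarith

/-- The second adjoint of a weakly compact operator maps the bidual into the codomain. -/
theorem IsWeaklyCompactOperator.exists_eval_eq {T : X →L[𝕜] Y} (hT : IsWeaklyCompactOperator T)
    (φ : StrongDual 𝕜 (StrongDual 𝕜 X)) :
    ∃ y : Y, ∀ g : StrongDual 𝕜 Y, φ (g.comp T) = g y := by
  rcases eq_or_ne φ 0 with rfl | hφ
  · exact ⟨0, fun g => by simp⟩
  have hφ' : (‖φ‖ : 𝕜) ≠ 0 := by simpa using hφ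
  obtain ⟨y, hy⟩ := hT.exists_eval_eq_of_norm_le_one ((‖φ‖ : 𝕜)⁻¹ • φ) (by
    rw [norm_smul, norm_inv, RCLike.norm_ofReal, abs_norm, inv_mul_cancel₀ (norm_ne_zero_iff.mpr hφ)])
  refine ⟨(‖φ‖ : 𝕜) • y, fun g => ?_⟩
  rw [map_smul, ← hy g, smul_apply, smul_inv_smul₀ hφ']

/-- The adjoint of a weakly compact operator is weakly compact. -/
theorem IsWeaklyCompactOperator.adjoint {T : X →L[𝕜] Y} (hT : IsWeaklyCompactOperator T) :
    RelativelyWeaklyCompact 𝕜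
      ((fun g : StrongDual 𝕜 Y => g.comp T) '' Metric.closedBall 0 1) := by
  have hcont : Continuous (fun g : WeakDual 𝕜 Y =>
      toWeakSpace 𝕜 (StrongDual 𝕜 X) ((WeakDual.toStrongDual g).comp T)) := by
    refine WeakSpace.continuous_of_continuous_eval fun φ => ?_
    obtain ⟨y, hy⟩ := hT.exists_eval_eq φ
    exact (WeakDual.eval_continuous y).congr fun g => (hy (WeakDual.toStrongDual g)).symm
  have hcomp := (WeakDual.isCompact_closedBall (𝕜 := 𝕜) (0 : StrongDual 𝕜 Y) 1).image hcont
  refine hcomp.of_isClosed_subset isClosed_closure (closure_minimal ?_ hcomp.isClosed)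
  rintro _ ⟨_, ⟨g, hg, rfl⟩, rfl⟩
  exact ⟨StrongDual.toWeakDual g, hg, rfl⟩

end Gantmacher

/-! ### Reduction of relative weak compactness to countable subsets. -/

section Eberlein

set_option maxSynthPendingDepth 3

/-- A separable set of functionals is normed, up to a constant, by a countable subset of the unit
ball. -/
theorem exists_countable_norming {𝕜 F : Type*} [RCLike 𝕜] [NormedAddCommGroup F]
    [NormedSpace 𝕜 F] {S : Set (StrongDual 𝕜 F)} (hS : TopologicalSpace.IsSeparable S) :
    ∃ D : Set F, D.Countable ∧ (∀ d ∈ D, ‖d‖ ≤ 1) ∧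
      ∀ w ∈ S, ∃ d ∈ D, ‖w‖ ≤ 4 * ‖w d‖ := by
  obtain ⟨c, hc, hSc⟩ := hS
  have hex : ∀ w : StrongDual 𝕜 F, ∃ d : F, ‖d‖ ≤ 1 ∧ ‖w‖ ≤ 2 * ‖w d‖ := by
    intro w
    rcases eq_or_ne w 0 with rfl | hw
    · exact ⟨0, by simp, by simp⟩
    · have hpos := norm_pos_iff.mpr hw
      obtain ⟨d, hd, hwd⟩ := w.exists_lt_apply_of_lt_opNorm (half_lt_self hpos)
      exact ⟨d, hd.le, by linarith⟩
  choose d hd hwd using hex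
  refine ⟨insert 0 (d '' c), (hc.image d).insert 0, ?_, fun w hw => ?_⟩
  · rintro _ (rfl | ⟨w, -, rfl⟩)
    · simp
    · exact hd w
  rcases eq_or_ne w 0 with rfl | hw0
  · exact ⟨0, mem_insert _ _, by simp⟩
  have hpos := norm_pos_iff.mpr hw0
  -- With error `‖w‖ / 8`, the factor 2 for `w'` gives `(5/8) ‖w‖ ≤ 2 ‖w (d w')‖`, within the factor
  -- 4.
  obtain ⟨w', hw', hdist⟩ := Metric.mem_closure_iff.mp (hSc hw) (‖w‖ / 8) (by positivity)
  refine ⟨d w', mem_insert_of_mem _ ⟨w', hw', rfl⟩, ?_⟩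
  rw [dist_eq_norm] at hdist
  have h1 : ‖w' (d w')‖ ≤ ‖w (d w')‖ + ‖w - w'‖ := by
    have h2 : ‖(w - w') (d w')‖ ≤ ‖w - w'‖ :=
      (w - w').unit_le_opNorm _ (hd w')
    have h3 := norm_sub_norm_le (w' (d w')) (w (d w'))
    rw [norm_sub_rev, ← sub_apply] at h3
    linarith
  have h4 : ‖w‖ ≤ ‖w'‖ + ‖w - w'‖ := by
    have := norm_sub_norm_le w w'
    linarith
  have := hwd w'
  linarith

/-- A norming property passes from a set of functionals to separation of points of its closure. -/
theorem eq_zero_of_mem_closure_of_norming {𝕜 F : Type*} [RCLike 𝕜] [NormedAddCommGroup F]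
    [NormedSpace 𝕜 F] {S : Set (StrongDual 𝕜 F)} {D : Set F} (hD : ∀ d ∈ D, ‖d‖ ≤ 1)
    (hSD : ∀ w ∈ S, ∃ d ∈ D, ‖w‖ ≤ 4 * ‖w d‖) {w : StrongDual 𝕜 F} (hw : w ∈ closure S)
    (h0 : ∀ d ∈ D, w d = 0) : w = 0 := by
  by_contra hne
  have hpos := norm_pos_iff.mpr hne
  obtain ⟨w', hw', hdist⟩ := Metric.mem_closure_iff.mp hw (‖w‖ / 8) (by positivity)
  obtain ⟨d, hd, hle⟩ := hSD w' hw'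
  rw [dist_eq_norm] at hdist
  have h1 : ‖w' d‖ ≤ ‖w - w'‖ := by
    have h2 := (w - w').unit_le_opNorm d (hD d hd)
    rwa [sub_apply, h0 d hd, zero_sub, norm_neg] at h2
  have h4 := norm_sub_norm_le w w'
  linarith

variable {𝕜 E : Type*} [RCLike 𝕜] [NormedAddCommGroup E] [NormedSpace 𝕜 E]

/-- A point of the weak-star closure of `A` in the bidual is, on a countable set of functionals,
approximated by a countable subset of `A`. -/
theorem exists_countable_approximating {A : Set E} {z : WeakDual 𝕜 (StrongDual 𝕜 E)}
    (hz : z ∈ closure (NormedSpace.inclusionInDoubleDualWeak 𝕜 E '' (toWeakSpace 𝕜 E '' A)))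
    {D : Set (StrongDual 𝕜 E)} (hD : D.Countable) :
    ∃ C ⊆ A, C.Countable ∧ ∀ t : Set (StrongDual 𝕜 E × ℕ), t.Finite → t ⊆ D ×ˢ univ →
      ∃ a ∈ C, ∀ p ∈ t, ‖z p.1 - p.1 a‖ ≤ 1 / ((p.2 : ℝ) + 1) := by
  have hex : ∀ t : Set (StrongDual 𝕜 E × ℕ), t.Finite →
      ∃ a ∈ A, ∀ p ∈ t, ‖z p.1 - p.1 a‖ ≤ 1 / ((p.2 : ℝ) + 1) := by
    intro t ht
    have hnhds : ∀ᶠ w in 𝓝 z, ∀ p ∈ t, ‖z p.1 - w p.1‖ ≤ 1 / ((p.2 : ℝ) + 1) := by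
      rw [eventually_all_finite ht]
      intro p _
      have hc : Continuous fun w : WeakDual 𝕜 (StrongDual 𝕜 E) => ‖z p.1 - w p.1‖ :=
        (continuous_const.sub (WeakDual.eval_continuous p.1)).norm
      refine (hc.tendsto z).eventually_le_const ?_
      simpa using by positivity
    obtain ⟨_, hw, _, ⟨a, ha, rfl⟩, rfl⟩ := mem_closure_iff_nhds.mp hz _ hnhds
    exact ⟨a, ha, hw⟩
  choose a haA ha using hex
  -- A pair encodes a functional and a tolerance; one point per finite set of pairs suffices, and
  -- there are countably many such sets.
  have hcount : {t : Set (StrongDual 𝕜 E × ℕ) | t.Finite ∧ t ⊆ D ×ˢ univ}.Countable :=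
    Set.countable_ofPred_finite_subset (hD.prod countable_univ)
  refine ⟨(fun t : {t : Set (StrongDual 𝕜 E × ℕ) | t.Finite ∧ t ⊆ D ×ˢ univ} => a t t.2.1) '' univ,
    ?_, ?_, fun t ht htD => ⟨_, ⟨⟨t, ht, htD⟩, mem_univ _, rfl⟩, ha t ht⟩⟩
  · rintro _ ⟨t, -, rfl⟩
    exact haA _ _
  · have := hcount.to_subtype
    exact countable_univ.image _

/-- Closing off: countable sets `C ⊆ A` and `D` such that `C` approximates `z` on `D`, while `D`
norms the span of `z` and `C`. -/
theorem exists_countable_approximating_norming {A : Set E} {z : WeakDual 𝕜 (StrongDual 𝕜 E)}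
    (hz : z ∈ closure (NormedSpace.inclusionInDoubleDualWeak 𝕜 E '' (toWeakSpace 𝕜 E '' A))) :
    ∃ C ⊆ A, C.Countable ∧ ∃ D : Set (StrongDual 𝕜 E), (∀ d ∈ D, ‖d‖ ≤ 1) ∧
      (∀ t : Set (StrongDual 𝕜 E × ℕ), t.Finite → t ⊆ D ×ˢ univ →
        ∃ a ∈ C, ∀ p ∈ t, ‖z p.1 - p.1 a‖ ≤ 1 / ((p.2 : ℝ) + 1)) ∧
      ∀ w ∈ Submodule.span 𝕜 (insert (WeakDual.toStrongDual z)
        (NormedSpace.inclusionInDoubleDual 𝕜 E '' C)), ∃ d ∈ D, ‖w‖ ≤ 4 * ‖w d‖ := by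
  let P := {p : Set E × Set (StrongDual 𝕜 E) //
    (p.1 ⊆ A ∧ p.1.Countable) ∧ (∀ d ∈ p.2, ‖d‖ ≤ 1) ∧ p.2.Countable}
  -- Each stage serves the preceding one. In the union, a finite set of conditions or a vector of
  -- the span already occurs at a finite stage.
  have step : ∀ p : P, ∃ q : P, (p.1.1 ⊆ q.1.1 ∧ p.1.2 ⊆ q.1.2) ∧
      (∀ t : Set (StrongDual 𝕜 E × ℕ), t.Finite → t ⊆ p.1.2 ×ˢ univ →
        ∃ a ∈ q.1.1, ∀ p ∈ t, ‖z p.1 - p.1 a‖ ≤ 1 / ((p.2 : ℝ) + 1)) ∧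
      ∀ w ∈ Submodule.span 𝕜 (insert (WeakDual.toStrongDual z)
        (NormedSpace.inclusionInDoubleDual 𝕜 E '' p.1.1)), ∃ d ∈ q.1.2, ‖w‖ ≤ 4 * ‖w d‖ := by
    rintro ⟨⟨C, D⟩, ⟨hCA, hC⟩, hD1, hD⟩
    obtain ⟨C', hC'A, hC', happ⟩ := exists_countable_approximating hz hD
    obtain ⟨D', hD', hD'1, hnorm⟩ := exists_countable_norming
      (((hC.image (NormedSpace.inclusionInDoubleDual 𝕜 E)).insert
        (WeakDual.toStrongDual z)).isSeparable.span (R := 𝕜))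
    refine ⟨⟨⟨C ∪ C', D ∪ D'⟩, ⟨union_subset hCA hC'A, hC.union hC'⟩, ?_, hD.union hD'⟩,
      ⟨subset_union_left, subset_union_left⟩, fun t ht htD => ?_, fun w hw => ?_⟩
    · rintro d (hd | hd)
      exacts [hD1 d hd, hD'1 d hd]
    · obtain ⟨a, ha, h⟩ := happ t ht htD
      exact ⟨a, Or.inr ha, h⟩
    · obtain ⟨d, hd, h⟩ := hnorm w hw
      exact ⟨d, Or.inr hd, h⟩
  choose next hmono happ hnorm using step
  let p₀ : P := ⟨⟨∅, ∅⟩, by simp⟩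
  let s : ℕ → P := fun n => next^[n] p₀
  have hs : ∀ n, s (n + 1) = next (s n) := fun n => Function.iterate_succ_apply' next n p₀
  have hm1 : Monotone fun n => (s n).1.1 := monotone_nat_of_le_succ fun n => by
    rw [hs]; exact (hmono _).1
  have hm2 : Monotone fun n => (s n).1.2 := monotone_nat_of_le_succ fun n => by
    rw [hs]; exact (hmono _).2
  refine ⟨⋃ n, (s n).1.1, iUnion_subset fun n => (s n).2.1.1,
    countable_iUnion fun n => (s n).2.1.2, ⋃ n, (s n).1.2, ?_, fun t ht htD => ?_, fun w hw => ?_⟩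
  · intro d hd
    obtain ⟨n, hn⟩ := mem_iUnion.mp hd
    exact (s n).2.2.1 d hn
  · have hm3 : Monotone fun n => (s n).1.2 ×ˢ (univ : Set ℕ) :=
      fun m n hmn => prod_mono (hm2 hmn) subset_rfl
    rw [iUnion_prod_const] at htD
    obtain ⟨n, hn⟩ := hm3.directed_le.exists_mem_subset_of_finset_subset_biUnion
      (s := ht.toFinset) (by simpa using htD)
    obtain ⟨a, ha, h⟩ := happ (s n) t ht (by simpa using hn)
    exact ⟨a, mem_iUnion.mpr ⟨n + 1, by rw [hs]; exact ha⟩, h⟩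
  · have hspan : ∃ n, w ∈ Submodule.span 𝕜 (insert (WeakDual.toStrongDual z)
        (NormedSpace.inclusionInDoubleDual 𝕜 E '' (s n).1.1)) := by
      have hm4 : Monotone fun n => Submodule.span 𝕜 (insert (WeakDual.toStrongDual z)
        (NormedSpace.inclusionInDoubleDual 𝕜 E '' (s n).1.1)) := fun m n hmn =>
        Submodule.span_mono (insert_subset_insert (image_mono (hm1 hmn)))
      rw [← Submodule.mem_iSup_of_directed _ hm4.directed_le, ← Submodule.span_iUnion,
        ← insert_iUnion, ← image_iUnion]
      exact hw
    obtain ⟨n, hn⟩ := hspan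
    obtain ⟨d, hd, h⟩ := hnorm (s n) w hn
    exact ⟨d, mem_iUnion.mpr ⟨n + 1, by rw [hs]; exact hd⟩, h⟩

/-- A bounded set is relatively weakly compact if all of its countable subsets are. -/
theorem relativelyWeaklyCompact_of_countable {𝕜 : Type} [RCLike 𝕜] {E : Type*}
    [NormedAddCommGroup E] [NormedSpace 𝕜 E] {A : Set E} (hA : Bornology.IsBounded A)
    (h : ∀ C ⊆ A, C.Countable → RelativelyWeaklyCompact 𝕜 C) : RelativelyWeaklyCompact 𝕜 A := by
  refine NormedSpace.isCompact_closure_of_isBounded 𝕜 E _ ?_ fun z hz => ?_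
  · rwa [preimage_image_eq _ (toWeakSpace 𝕜 E).injective]
  obtain ⟨C, hCA, hC, D, hD1, happ, hnorm⟩ := exists_countable_approximating_norming hz
  -- Compactness gives a weak closure point `a` of `C` agreeing with `z` on `D`.
  have hK := h C hCA hC
  obtain ⟨a, haK, ha⟩ : (closure (toWeakSpace 𝕜 E '' C) ∩ ⋂ i : D × ℕ, {x : WeakSpace 𝕜 E |
      ‖z i.1 - i.1.1 ((toWeakSpace 𝕜 E).symm x)‖ ≤ 1 / ((i.2 : ℝ) + 1)}).Nonempty := by
    refine hK.inter_iInter_nonempty _ (fun i => ?_) fun u => ?_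
    · exact isClosed_le (continuous_const.sub (WeakSpace.continuous_eval i.1.1)).norm
        continuous_const
    · obtain ⟨a, haC, ha⟩ := happ ((fun i : D × ℕ => ((i.1 : StrongDual 𝕜 E), i.2)) '' u)
        (u.finite_toSet.image _) (by rintro _ ⟨i, -, rfl⟩; exact ⟨i.1.2, mem_univ _⟩)
      refine ⟨toWeakSpace 𝕜 E a, subset_closure ⟨a, haC, rfl⟩, ?_⟩
      simp only [mem_iInter]
      intro i hi
      exact ha _ ⟨i, hi, rfl⟩
  have heq : ∀ d ∈ D, z d = d ((toWeakSpace 𝕜 E).symm a) := by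
    intro d hd
    rw [← sub_eq_zero, ← norm_le_zero_iff]
    refine ge_of_tendsto' (tendsto_one_div_add_atTop_nhds_zero_nat (𝕜 := ℝ)) fun n => ?_
    exact mem_iInter.mp ha (⟨d, hd⟩, n)
  let M := Submodule.span 𝕜 (insert (WeakDual.toStrongDual z)
        (NormedSpace.inclusionInDoubleDual 𝕜 E '' C))
  have haM : NormedSpace.inclusionInDoubleDual 𝕜 E ((toWeakSpace 𝕜 E).symm a) ∈
      M.topologicalClosure := by
    -- By Mazur's theorem `a` is in the norm closure of the span of `C`. So `z - a` lies in the
    -- closure of `M`, where vanishing on `D` forces it to be zero.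
    have h1 : a ∈ closure (toWeakSpace 𝕜 E '' (Submodule.span 𝕜 C : Set E)) :=
      closure_mono (image_mono Submodule.subset_span) haK
    let _ := NormedSpace.restrictScalars ℝ 𝕜 E
    obtain ⟨b, hb, rfl⟩ :=
      (Convex.toWeakSpace_closure 𝕜 ((Submodule.span 𝕜 C).restrictScalars ℝ).convex).ge h1
    rw [LinearEquiv.symm_apply_apply]
    refine map_mem_closure (NormedSpace.inclusionInDoubleDual 𝕜 E).continuous hb fun x hx => ?_
    have : Submodule.span 𝕜 C ≤ M.comap (NormedSpace.inclusionInDoubleDual 𝕜 E).toLinearMap :=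
      Submodule.span_le.mpr fun c hc => Submodule.subset_span (mem_insert_of_mem _ ⟨c, hc, rfl⟩)
    exact this hx
  have hzM : WeakDual.toStrongDual z ∈ M.topologicalClosure :=
    M.le_topologicalClosure (Submodule.subset_span (mem_insert _ _))
  have hzero := eq_zero_of_mem_closure_of_norming hD1 hnorm
    (M.topologicalClosure.sub_mem hzM haM) fun d hd => by
      simpa [sub_eq_zero] using heq d hd
  exact ⟨a, congrArg StrongDual.toWeakDual (sub_eq_zero.mp hzero).symm⟩

end Eberlein

/-! ### Sequences of functionals as operators into `ℓ^∞`. -/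

section LInfty

set_option maxSynthPendingDepth 3

variable {𝕜 : Type} [RCLike 𝕜] {X : Type*} [NormedAddCommGroup X] [NormedSpace 𝕜 X]

/-- A bounded sequence of functionals, as an operator into `ℓ^∞`. -/
theorem exists_toLInfty {f : ℕ → StrongDual 𝕜 X} {M : ℝ} (hf : ∀ n, ‖f n‖ ≤ M) :
    ∃ T : X →L[𝕜] lp (fun _ : ℕ => 𝕜) ∞, ∀ x n, T x n = f n x := by
  have hb : ∀ x n, ‖f n x‖ ≤ M * ‖x‖ := fun x n => (f n).le_of_opNorm_le (hf n) x
  let L : X →ₗ[𝕜] lp (fun _ : ℕ => 𝕜) ∞ :=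
    { toFun := fun x => ⟨fun n => f n x, memℓp_infty ⟨M * ‖x‖, by
        rintro _ ⟨n, rfl⟩; exact hb x n⟩⟩
      map_add' := fun x y => by ext n; exact map_add (f n) x y
      map_smul' := fun c x => by ext n; exact map_smul (f n) c x }
  have hM : 0 ≤ M := (norm_nonneg _).trans (hf 0)
  exact ⟨L.mkContinuous M fun x =>
    lp.norm_le_of_forall_le (mul_nonneg hM (norm_nonneg x)) fun n => hb x n, fun x n => rfl⟩

/-- If all Dunford-Pettis completely continuous operators into `ℓ^∞` are weakly compact, then
countable L-Dunford-Pettis sets are relatively weakly compact. -/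
theorem IsLDPSet.relativelyWeaklyCompact_range
    (h : ∀ T : X →L[𝕜] lp (fun _ : ℕ => 𝕜) ∞, IsDPcc T → IsWeaklyCompactOperator T)
    {f : ℕ → StrongDual 𝕜 X} (hf : IsLDPSet 𝕜 (range f)) :
    RelativelyWeaklyCompact 𝕜 (range f) := by
  obtain ⟨M, hM⟩ := hf.1.exists_norm_le
  obtain ⟨T, hT⟩ := exists_toLInfty fun n => hM (f n) (mem_range_self n)
  have hcc : IsDPcc T := by
    intro x hx hDP
    have hu := hf.2 x hx hDP
    rw [Metric.tendstoUniformlyOn_iff] at hu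
    rw [Metric.tendsto_nhds]
    intro ε hε
    filter_upwards [hu (ε / 2) (half_pos hε)] with n hn
    rw [dist_zero_right]
    refine (lp.norm_le_of_forall_le (half_pos hε).le fun k => ?_).trans_lt (half_lt_self hε)
    have := hn (f k) (mem_range_self k)
    rw [dist_zero_left] at this
    rw [hT]
    exact this.le
  refine (h T hcc).adjoint.of_isClosed_subset isClosed_closure (closure_mono (image_mono ?_))
  rintro _ ⟨n, rfl⟩
  -- The `n`-th coordinate functional has norm at most 1 and pulls back along `T` to `f n`.
  refine ⟨lp.evalCLM 𝕜 (fun _ : ℕ => 𝕜) ∞ n, ?_, ?_⟩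
  · rw [mem_closedBall_zero_iff]
    exact LinearMap.mkContinuous_norm_le _ zero_le_one _
  · ext x
    exact hT x n

end LInfty

/-! ### DPcc operators, L-Dunford-Pettis sets and the equivalence. -/

section Equivalence

set_option maxSynthPendingDepth 3

variable {𝕜 : Type} [RCLike 𝕜]

/-- Subsets of L-Dunford-Pettis sets are L-Dunford-Pettis sets. -/
theorem IsLDPSet.mono {X : Type*} [NormedAddCommGroup X] [NormedSpace 𝕜 X]
    {A B : Set (StrongDual 𝕜 X)} (hB : IsLDPSet 𝕜 B) (hAB : A ⊆ B) : IsLDPSet 𝕜 A :=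
  ⟨hB.1.subset hAB, fun x hx hDP => (hB.2 x hx hDP).mono hAB⟩

/-- The adjoint of a Dunford-Pettis completely continuous operator maps the unit ball onto an
L-Dunford-Pettis set. -/
theorem IsDPcc.isLDPSet_adjoint {X Y : Type*} [NormedAddCommGroup X] [NormedSpace 𝕜 X]
    [NormedAddCommGroup Y] [NormedSpace 𝕜 Y] {T : X →L[𝕜] Y} (hT : IsDPcc T) :
    IsLDPSet 𝕜 ((fun g : StrongDual 𝕜 Y => g.comp T) '' Metric.closedBall 0 1) := by
  let L : StrongDual 𝕜 Y →L[𝕜] StrongDual 𝕜 X := ContinuousLinearMap.precomp 𝕜 T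
  refine ⟨L.lipschitz.isBounded_image Metric.isBounded_closedBall, fun x hx hDP => ?_⟩
  rw [Metric.tendstoUniformlyOn_iff]
  intro ε hε
  filter_upwards [Metric.tendsto_nhds.mp (hT x hx hDP) ε hε] with n hn
  rintro _ ⟨g, hg, rfl⟩
  rw [dist_zero_right] at hn
  rw [dist_zero_left]
  rw [mem_closedBall_zero_iff] at hg
  calc ‖g (T (x n))‖ ≤ 1 * ‖T (x n)‖ := g.le_of_opNorm_le hg _
    _ < ε := by rwa [one_mul]

/-- Composing a weakly compact operator with a bounded operator gives a weakly compact operator. -/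
theorem IsWeaklyCompactOperator.comp_left {X Y Z : Type*} [NormedAddCommGroup X] [NormedSpace 𝕜 X]
    [NormedAddCommGroup Y] [NormedSpace 𝕜 Y] [NormedAddCommGroup Z] [NormedSpace 𝕜 Z]
    {T : X →L[𝕜] Y} (hT : IsWeaklyCompactOperator T) (S : Y →L[𝕜] Z) :
    IsWeaklyCompactOperator (S.comp T) := by
  have hcomp := IsCompact.image hT (WeakSpace.map S).continuous
  refine hcomp.of_isClosed_subset isClosed_closure (closure_minimal ?_ hcomp.isClosed)
  rintro _ ⟨_, ⟨x, hx, rfl⟩, rfl⟩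
  exact ⟨_, subset_closure ⟨_, ⟨x, hx, rfl⟩, rfl⟩, rfl⟩

/-- Composing a Dunford-Pettis completely continuous operator with a bounded operator gives a
Dunford-Pettis completely continuous operator. -/
theorem IsDPcc.comp_left {X Y Z : Type*} [NormedAddCommGroup X] [NormedSpace 𝕜 X]
    [NormedAddCommGroup Y] [NormedSpace 𝕜 Y] [NormedAddCommGroup Z] [NormedSpace 𝕜 Z]
    {T : X →L[𝕜] Y} (hT : IsDPcc T) (S : Y →L[𝕜] Z) : IsDPcc (S.comp T) := fun x hx hDP => by
  simpa using! (S.continuous.tendsto 0).comp (hT x hx hDP)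

/-- The implication from complete continuity to weak compactness for all codomains in some
universe descends to codomains in smaller universes. -/
theorem isWeaklyCompactOperator_of_ulift {X : Type*} {Y : Type u} [NormedAddCommGroup X]
    [NormedSpace 𝕜 X] [NormedAddCommGroup Y] [NormedSpace 𝕜 Y] (T : X →L[𝕜] Y) (hT : IsDPcc T)
    (h : ∀ S : X →L[𝕜] ULift.{v} Y, IsDPcc S → IsWeaklyCompactOperator S) :
    IsWeaklyCompactOperator T := by
  let e : ULift.{v} Y ≃L[𝕜] Y := ContinuousLinearEquiv.ulift
  exact (h _ (hT.comp_left (e.symm : Y →L[𝕜] ULift.{v} Y))).comp_left (e : ULift.{v} Y →L[𝕜] Y)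

end Equivalence

theorem mainTheorem1 (𝕜 : Type) [RCLike 𝕜]
    (X : Type u) [NormedAddCommGroup X] [NormedSpace 𝕜 X] [CompleteSpace X] :
    List.TFAE
      [HasLDPProperty 𝕜 X,
       ∀ (Y : Type v) [NormedAddCommGroup Y] [NormedSpace 𝕜 Y] [CompleteSpace Y]
         (T : X →L[𝕜] Y), IsDPcc T → IsWeaklyCompactOperator T,
       ∀ T : X →L[𝕜] lp (fun _ : ℕ => 𝕜) ∞, IsDPcc T → IsWeaklyCompactOperator T] := by
  tfae_have 1 → 2 := fun h Y _ _ _ T hT =>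
    isWeaklyCompactOperator_of_adjoint T (h _ hT.isLDPSet_adjoint)
  tfae_have 2 → 3 := by
    intro h T hT
    -- `ℓ^∞` lives in the lowest universe, so it is lifted to that of the codomains `Y`.
    exact isWeaklyCompactOperator_of_ulift T hT fun S hS =>
      h (ULift.{v} (lp (fun _ : ℕ => 𝕜) ∞)) S hS
  tfae_have 3 → 1 := by
    intro h A hA
    refine relativelyWeaklyCompact_of_countable hA.1 fun C hCA hC => ?_
    rcases C.eq_empty_or_nonempty with rfl | hne
    · simp [RelativelyWeaklyCompact]
    obtain ⟨f, rfl⟩ := hC.exists_eq_range hne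
    exact IsLDPSet.relativelyWeaklyCompact_range h (hA.mono hCA)
  tfae_finish
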